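/- Let $(X,d)$ be a compact metric space and let $\mu$ be a Radon measure on $X$ that is positive and doubling: there is $C_D>0$ with $$0<\mu(B(x,2r))\le C_D\,\mu(B(x,r))<\infty\qquad\text{for all }x\in X,\ r>0,$$ where $B(x,r)=\{y\in X: d(x,y)<r\}$. Let $Q$ be an exponent for which there is $C_Q>0$ with $$\frac{\mu(B(x,R))}{\mu(B(x,r))}\le C_Q\Big(\frac Rr\Big)^{Q}\qquad\text{for all }x\in X,\ 0<r\le R.$$ Let $d_w>2$. For $f\in L^2(X,\mu)$ (real-valued), a Borel set $U\subseteq X$ and $r>0$, put $$E_{d_w/2,U}(f,r):=\int_U\frac{1}{\mu(B(x,r))}\int_{B(x,r)}\frac{|f(y)-f(x)|^2}{r^{d_w}}\,d\mu(y)\,d\mu(x),$$ and let $$KS^{d_w/2,2}(X):=\Big\{f\in L^2(X,\mu):\ \limsup_{r\to0^+}E_{d_w/2,X}(f,r)<\infty\Big\}.$$ Assume the following $2$-Poincaré inequality: there are constants $C>0$ and $\lambda\ge1$ such that, for all $f\in KS^{d_w/2,2}(X)$, $x\in X$ and $R>0$, $$\int_{B(x,R)}|f(y)-f_{B(x,R)}|^2\,d\mu(y)\le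 C\,R^{d_w}\liminf_{r\to0^+}E_{d_w/2,B(x,\lambda R)}(f,r),$$ where $f_{B(x,R)}:=\frac{1}{\mu(B(x,R))}\int_{B(x,R)}f\,d\mu$. Assume $Q>d_w$. Then any sequence $\{f_n\}_{n\ge1}\subset KS^{d_w/2,2}(X)$ such that $$\sup_{n\ge1}\Big(\|f_n\|_{L^2(X,\mu)}+\liminf_{r\to0^+}E_{d_w/2,X}(f_n,r)\Big)<\infty$$ contains a subsequence which converges in $L^\alpha(X,\mu)$, to one and the same limit function, for every $1\le\alpha<\frac{2Q}{Q-d_w}$. -/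

import Mathlib

open MeasureTheory Filter Topology Metric
open scoped ENNReal NNReal

/-- Volume doubling and positivity: there is `C > 0` such that
`0 < μ (B(x,2r)) ≤ C μ (B(x,r)) < ∞` for every `x` and every `r > 0`. -/
def VolumeDoubling {X : Type*} [MetricSpace X] [MeasurableSpace X] (μ : Measure X) : Prop :=
  ∃ C : ℝ≥0, 0 < C ∧ ∀ (x : X) (r : ℝ), 0 < r →
    0 < μ (ball x (2 * r)) ∧ μ (ball x (2 * r)) ≤ C * μ (ball x r) ∧ μ (ball x r) < ∞

/-- `Q` is a volume growth exponent of `μ`: there is `C > 0` such that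
`μ (B(x,R)) / μ (B(x,r)) ≤ C (R / r) ^ Q` for every `x` and all `0 < r ≤ R`. -/
def HasMassBound {X : Type*} [MetricSpace X] [MeasurableSpace X] (μ : Measure X)
    (Q : ℝ) : Prop :=
  ∃ C : ℝ, 0 < C ∧ ∀ (x : X) (r R : ℝ), 0 < r → r ≤ R →
    μ (ball x R) ≤ ENNReal.ofReal (C * (R / r) ^ Q) * μ (ball x r)

/-- The Korevaar-Schoen energy at scale `r` on a set `U`, with walk dimension `dw`, i.e.
`∫_U (1 / μ (B(x,r))) ∫_{B(x,r)} |f y - f x|² / r ^ dw dμ(y) dμ(x)`, as an extended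
nonnegative number. The inner ball `B(x,r)` is not intersected with `U`. -/
noncomputable def ksEnergy {X : Type*} [MetricSpace X] [MeasurableSpace X] (μ : Measure X)
    (dw : ℝ) (U : Set X) (f : X → ℝ) (r : ℝ) : ℝ≥0∞ :=
  ∫⁻ x in U, (μ (ball x r))⁻¹ *
    ∫⁻ y in ball x r, ENNReal.ofReal (|f y - f x| ^ 2 / r ^ dw) ∂μ ∂μ

/-- The Korevaar-Schoen space `KS^{dw/2,2}(X)`: the square integrable functions with
`limsup_{r → 0+} E_{dw/2,X}(f,r) < ∞`. Everything here is invariant under changes of `f`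
on `μ`-null sets, so functions stand for their classes in `L²`. -/
def KSSpace {X : Type*} [MetricSpace X] [MeasurableSpace X] (μ : Measure X)
    (dw : ℝ) : Set (X → ℝ) :=
  {f | MemLp f 2 μ ∧ limsup (fun r => ksEnergy μ dw Set.univ f r) (𝓝[>] 0) < ∞}

/-- The 2-Poincaré inequality with Korevaar-Schoen energies: there are constants `C > 0` and
`lam ≥ 1` such that, for all `f ∈ KS^{dw/2,2}(X)`, all `x` and all `R > 0`,
`∫_{B(x,R)} |f y - f_{B(x,R)}|² dμ(y) ≤ C R ^ dw liminf_{r → 0+} E_{dw/2,B(x,lam R)}(f,r)`,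
where `f_{B(x,R)}` is the average of `f` over `B(x,R)`. -/
def KSPoincare {X : Type*} [MetricSpace X] [MeasurableSpace X] (μ : Measure X)
    (dw : ℝ) : Prop :=
  ∃ C lam : ℝ, 0 < C ∧ 1 ≤ lam ∧ ∀ f ∈ KSSpace μ dw, ∀ (x : X) (R : ℝ), 0 < R →
    ∫⁻ y in ball x R, ENNReal.ofReal (|f y - ⨍ z in ball x R, f z ∂μ| ^ 2) ∂μ ≤
      ENNReal.ofReal (C * R ^ dw) *
        liminf (fun r => ksEnergy μ dw (ball x (lam * R)) f r) (𝓝[>] 0)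

/-!
The compactness comes from approximating all the functions `f n` at once by step functions.
At the scale `ρ = 2 ^ (-k)` choose a finite `ρ / 2`-separated net, send each point `x` measurably to
a point `π x` of the net at distance less than `ρ`, and let `P_k f` be the function
`x ↦ ⨍ z in ball (π x) ρ, f z ∂μ`.

Two estimates hold with constants that depend only on the bound for the `L²` norms and energies.
* `‖P_k f - f‖₂² ≤ A ρ ^ dw` (`eLpNorm_average_sub_sq_le`): sum the Poincaré inequality over the
  net. The enlarged balls overlap boundedly (`HasMassBound.exists_overlap_bound`), and the lower
  limits of the energies add up because the lower limit is superadditive.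
* `|P_{k+1} f - P_k f|² ≤ B ρ ^ (dw - Q)` pointwise (`sq_average_sub_average_le`): both averages are
  compared with the average over `ball (π x) (2 ρ)`, and the mass of a ball of radius `ρ` is at
  least `c ρ ^ Q` (`HasMassBound.exists_lower_bound`).

Interpolating the increments between `L²` and `L^∞` bounds `‖P_{k+1} f - P_k f‖_α` by a multiple of
`ρ ^ δ` with `δ = ((dw - Q) (α / 2 - 1) + dw) / α`, and `δ > 0` is precisely the condition
`α < 2 Q / (Q - dw)`. Summing the geometric series, `P_k f → f` in `L^α` uniformly over the sequence
(`exists_eLpNorm_rate`); in particular no separate Sobolev embedding is needed. The values of the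
functions `P_k (f n)` are countably many bounded real sequences, so along one subsequence all of them
converge, and `P_k (f n)` converges uniformly for each `k`. Hence the subsequence converges in every
such `L^α` with `α ≥ 2`, always to its `L²` limit (`exists_tendsto_of_approx`). Smaller exponents
follow because the measure is finite.
-/

/-! ### Nets and measurable selections -/

theorem exists_finset_separated_cover {X : Type*} [MetricSpace X] [CompactSpace X] {r : ℝ}
    (hr : 0 < r) :
    ∃ s : Finset X, (∀ p ∈ s, ∀ q ∈ s, p ≠ q → r / 2 < dist p q) ∧
      ∀ x, ∃ p ∈ s, dist x p < r := by
  obtain ⟨ε, hε⟩ : ∃ ε : ℝ≥0, (ε : ℝ) = r / 4 := ⟨⟨r / 4, by positivity⟩, rfl⟩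
  have hε0 : ε ≠ 0 := by
    rintro rfl
    rw [NNReal.coe_zero] at hε
    linarith
  obtain ⟨N, -, hNf, hN⟩ := exists_finite_isCover_of_isCompact hε0 (isCompact_univ (X := X))
  have hpack : packingNumber (2 * ε) (Set.univ : Set X) ≠ ⊤ := by
    refine ne_top_of_le_ne_top ?_ (packingNumber_two_mul_le_externalCoveringNumber ε Set.univ)
    refine ne_top_of_le_ne_top (Set.encard_ne_top_iff.2 hNf) ?_
    exact iInf₂_le _ hN
  obtain hsep := isSeparated_maximalSeparatedSet (ε := 2 * ε) (A := (Set.univ : Set X))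
  have hcov := isCover_maximalSeparatedSet hpack
  have hfin : (maximalSeparatedSet (2 * ε) (Set.univ : Set X)).Finite := by
    rw [← Set.encard_ne_top_iff, encard_maximalSeparatedSet hpack]; exact hpack
  have h2 : ((2 * ε : ℝ≥0) : ℝ) = r / 2 := by
    rw [NNReal.coe_mul, hε, NNReal.coe_ofNat]; ring
  refine ⟨hfin.toFinset, fun p hp q hq hpq => ?_, fun x => ?_⟩
  · have : ((2 * ε : ℝ≥0) : ℝ≥0∞) < edist p q :=
      hsep (hfin.mem_toFinset.1 hp) (hfin.mem_toFinset.1 hq) hpq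
    rw [edist_nndist] at this
    have h3 : ((2 * ε : ℝ≥0) : ℝ) < nndist p q := by exact_mod_cast this
    rwa [h2, coe_nndist] at h3
  · rw [isCover_iff_subset_iUnion_closedBall] at hcov
    have := hcov (Set.mem_univ x)
    simp only [Set.mem_iUnion, mem_closedBall] at this
    obtain ⟨p, hp, hxp⟩ := this
    rw [h2] at hxp
    exact ⟨p, hfin.mem_toFinset.2 hp, by linarith⟩

/-- A finite cover by balls admits a selection of centres which takes finitely many values on
measurable sets, so that every function of the centre becomes measurable. -/
theorem exists_measurable_selection {X : Type*} [MetricSpace X] [MeasurableSpace X]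
    [BorelSpace X] [Nonempty X] (s : Finset X) (r : ℝ) :
    ∃ π : X → X, (∀ a : X → ℝ, Measurable fun x => a (π x)) ∧
      ∀ x, (∃ p ∈ s, dist x p < r) → π x ∈ s ∧ dist x (π x) < r := by
  classical
  induction s using Finset.induction_on with
  | empty => exact ⟨fun _ => Classical.arbitrary X, fun a => measurable_const, by simp⟩
  | insert p s hp ih =>
    obtain ⟨π, hm, hπ⟩ := ih
    refine ⟨fun x => if x ∈ ball p r then p else π x, fun a => ?_, fun x hx => ?_⟩
    · have : (fun x => a (if x ∈ ball p r then p else π x)) =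
          fun x => if x ∈ ball p r then a p else a (π x) := by
        ext x; split_ifs <;> rfl
      rw [this]
      exact Measurable.ite measurableSet_ball measurable_const (hm a)
    · by_cases h : x ∈ ball p r
      · simp only [h, if_true]
        exact ⟨Finset.mem_insert_self _ _, h⟩
      · simp only [h, if_false]
        obtain ⟨q, hq, hxq⟩ := hx
        rcases Finset.mem_insert.1 hq with rfl | hq
        · exact absurd hxq h
        · exact ⟨Finset.mem_insert_of_mem (hπ x ⟨q, hq, hxq⟩).1, (hπ x ⟨q, hq, hxq⟩).2⟩

/-! ### Mass of balls and bounded overlap -/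

theorem VolumeDoubling.measure_ball_pos {X : Type*} [MetricSpace X] [MeasurableSpace X]
    {μ : Measure X} (h : VolumeDoubling μ) (x : X) {r : ℝ} (hr : 0 < r) : 0 < μ (ball x r) := by
  obtain ⟨C, -, h⟩ := h
  have := (h x (r / 2) (by positivity)).1
  rwa [mul_div_cancel₀ r two_ne_zero] at this

theorem VolumeDoubling.measureReal_ball_pos {X : Type*} [MetricSpace X] [MeasurableSpace X]
    {μ : Measure X} [IsFiniteMeasure μ] (h : VolumeDoubling μ) (x : X) {r : ℝ} (hr : 0 < r) :
    0 < μ.real (ball x r) :=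
  ENNReal.toReal_pos (h.measure_ball_pos x hr).ne' (measure_ne_top _ _)

theorem HasMassBound.exists_measureReal_le {X : Type*} [MetricSpace X] [MeasurableSpace X]
    {μ : Measure X} [IsFiniteMeasure μ] {Q : ℝ} (h : HasMassBound μ Q) :
    ∃ C : ℝ, 0 < C ∧ ∀ (x : X) (r R : ℝ), 0 < r → r ≤ R →
      μ.real (ball x R) ≤ C * (R / r) ^ Q * μ.real (ball x r) := by
  obtain ⟨C, hC, h⟩ := h
  refine ⟨C, hC, fun x r R hr hR => ?_⟩
  have h1 := ENNReal.toReal_mono (ENNReal.mul_ne_top ENNReal.ofReal_ne_top (measure_ne_top _ _))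
    (h x r R hr hR)
  have : 0 ≤ C * (R / r) ^ Q := by
    have : 0 ≤ R / r := div_nonneg (hr.le.trans hR) hr.le
    positivity
  rwa [ENNReal.toReal_mul, ENNReal.toReal_ofReal this] at h1

/-- The lower volume bound `c r ^ Q ≤ μ (B(x,r))` at scales `r ≤ 1`. -/
theorem HasMassBound.exists_lower_bound {X : Type*} [MetricSpace X] [CompactSpace X]
    [MeasurableSpace X] {μ : Measure X} [IsFiniteMeasure μ] (hVD : VolumeDoubling μ)
    {Q : ℝ} (h : HasMassBound μ Q) :
    ∃ c : ℝ, 0 < c ∧ ∀ (x : X) (r : ℝ), 0 < r → r ≤ 1 → c * r ^ Q ≤ μ.real (ball x r) := by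
  rcases isEmpty_or_nonempty X with hX | ⟨⟨x₀⟩⟩
  · exact ⟨1, one_pos, fun x => isEmptyElim x⟩
  obtain ⟨C, hC, h⟩ := h.exists_measureReal_le
  set D : ℝ := Metric.diam (Set.univ : Set X) + 1 with hD
  have hD1 : 1 ≤ D := by have := Metric.diam_nonneg (s := (Set.univ : Set X)); linarith
  have hD0 : 0 < D := by linarith
  have hball : ∀ x : X, ball x D = Set.univ := fun x => by
    ext y
    have := Metric.dist_le_diam_of_mem isCompact_univ.isBounded (Set.mem_univ y) (Set.mem_univ x)
    simp only [mem_ball, Set.mem_univ, iff_true]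
    linarith
  have hV : 0 < μ.real (Set.univ : Set X) := by
    rw [← hball x₀]; exact hVD.measureReal_ball_pos x₀ hD0
  refine ⟨μ.real Set.univ / (C * D ^ Q), by positivity, fun x r hr hr1 => ?_⟩
  have h1 := h x r D hr (hr1.trans hD1)
  rw [hball, Real.div_rpow hD0.le hr.le] at h1
  have hrQ : 0 < r ^ Q := by positivity
  have hDQ : 0 < D ^ Q := by positivity
  calc μ.real Set.univ / (C * D ^ Q) * r ^ Q
      ≤ (C * (D ^ Q / r ^ Q) * μ.real (ball x r)) / (C * D ^ Q) * r ^ Q := by gcongr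
    _ = μ.real (ball x r) := by field_simp

/-- Balls around separated points have bounded overlap, uniformly in the scale: the balls of half
the separation are disjoint, of comparable mass, and contained in one ball of comparable mass. -/
theorem HasMassBound.exists_overlap_bound {X : Type*} [MetricSpace X]
    [MeasurableSpace X] [BorelSpace X] {μ : Measure X} [IsFiniteMeasure μ]
    (hVD : VolumeDoubling μ) {Q : ℝ} (h : HasMassBound μ Q) {lam : ℝ} (hlam : 1 ≤ lam) :
    ∃ N : ℕ, ∀ (r : ℝ) (s : Finset X), 0 < r →
      (∀ p ∈ s, ∀ q ∈ s, p ≠ q → r / 2 < dist p q) →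
      ∀ y : X, {p : s | y ∈ ball (p : X) (lam * r)}.encard ≤ N := by
  classical
  obtain ⟨C, hC, h⟩ := h.exists_measureReal_le
  set T : ℝ := C * (4 * (2 * lam + 1)) ^ Q with hT
  have hT0 : 0 < T := by positivity
  refine ⟨⌈T⌉₊, fun r s hr hs y => ?_⟩
  set t : Finset X := s.filter fun p => y ∈ ball p (lam * r) with ht
  have hts : ∀ p ∈ t, p ∈ s ∧ dist y p < lam * r := fun p hp => by
    simpa [ht] using hp
  have hset : {p : s | y ∈ ball (p : X) (lam * r)}.encard = t.card := by
    rw [← Set.encard_coe_eq_coe_finsetCard, ← Subtype.val_injective.encard_image]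
    congr 1
    ext p
    simp [ht, and_comm]
  rw [hset]
  have hV : 0 < μ.real (ball y ((lam + 1) * r)) := hVD.measureReal_ball_pos y (by positivity)
  have hlow : ∀ p ∈ t, μ.real (ball y ((lam + 1) * r)) ≤ T * μ.real (ball p (r / 4)) := by
    intro p hp
    have h1 : ball y ((lam + 1) * r) ⊆ ball p ((2 * lam + 1) * r) := by
      apply ball_subset_ball'
      have := (hts p hp).2
      nlinarith
    have h2 := h p (r / 4) ((2 * lam + 1) * r) (by positivity) (by nlinarith)
    have h3 : (2 * lam + 1) * r / (r / 4) = 4 * (2 * lam + 1) := by field_simp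
    rw [h3] at h2
    exact (measureReal_mono h1).trans h2
  have hdisj : Set.PairwiseDisjoint (t : Set X) fun p => ball p (r / 4) := by
    intro p hp q hq hpq
    apply ball_disjoint_ball
    have := hs p (hts p hp).1 q (hts q hq).1 hpq
    linarith
  have hsum : ∑ p ∈ t, μ.real (ball p (r / 4)) ≤ μ.real (ball y ((lam + 1) * r)) := by
    rw [← measureReal_biUnion_finset hdisj fun p _ => measurableSet_ball]
    refine measureReal_mono (Set.iUnion₂_subset fun p hp => ball_subset_ball' ?_)
    have := (hts p hp).2
    rw [dist_comm] at this
    linarith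
  have hcard : (t.card : ℝ) ≤ T := by
    have h1 : (t.card : ℝ) * μ.real (ball y ((lam + 1) * r)) ≤
        T * μ.real (ball y ((lam + 1) * r)) := by
      calc (t.card : ℝ) * μ.real (ball y ((lam + 1) * r))
          = ∑ p ∈ t, μ.real (ball y ((lam + 1) * r)) := by simp
        _ ≤ ∑ p ∈ t, T * μ.real (ball p (r / 4)) := Finset.sum_le_sum hlow
        _ = T * ∑ p ∈ t, μ.real (ball p (r / 4)) := by rw [Finset.mul_sum]
        _ ≤ _ := by gcongr
    exact le_of_mul_le_mul_right h1 hV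
  exact_mod_cast hcard.trans (Nat.le_ceil T)

/-! ### Lower limits and averages -/

theorem sum_liminf_le_liminf_sum {ι β : Type*} {l : Filter β} (s : Finset ι)
    (u : ι → β → ℝ≥0∞) :
    ∑ i ∈ s, liminf (u i) l ≤ liminf (fun b => ∑ i ∈ s, u i b) l := by
  simp only [liminf_eq_iSup_iInf, iSup_subtype' (p := fun t => t ∈ l)]
  rw [ENNReal.finsetSum_iSup fun t₁ t₂ => ⟨⟨t₁ ∩ t₂, inter_mem t₁.2 t₂.2⟩, fun i =>
    ⟨biInf_mono fun _ h => h.1, biInf_mono fun _ h => h.2⟩⟩]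
  exact iSup_mono fun t => le_iInf₂ fun b hb => Finset.sum_le_sum fun i _ => iInf₂_le b hb

/-- Jensen's inequality for the square, with a shift. -/
theorem sq_setAverage_sub_mul_le {X : Type*} [MeasurableSpace X] {μ : Measure X}
    [IsFiniteMeasure μ] {f : X → ℝ} (hf : MemLp f 2 μ) (s : Set X) (c : ℝ) :
    ((⨍ z in s, f z ∂μ) - c) ^ 2 * μ.real s ≤ ∫ z in s, (f z - c) ^ 2 ∂μ := by
  set a := ⨍ z in s, f z ∂μ with ha
  have hfi : Integrable f (μ.restrict s) :=
    (hf.integrable one_le_two).restrict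
  have hc : MemLp (fun z => f z - c) 2 (μ.restrict s) :=
    (hf.sub (memLp_const c)).restrict s
  have hsq : Integrable (fun z => (f z - c) ^ 2) (μ.restrict s) := hc.integrable_sq
  have hlin : Integrable (fun z => (a - c) ^ 2 + 2 * (a - c) * (f z - a)) (μ.restrict s) :=
    (integrable_const _).add ((hfi.sub (integrable_const _)).const_mul _)
  have key : ∫ z in s, ((a - c) ^ 2 + 2 * (a - c) * (f z - a)) ∂μ = (a - c) ^ 2 * μ.real s := by
    have h0 : ∫ z in s, (f z - a) ∂μ = 0 := by
      rw [integral_sub hfi (integrable_const _), integral_const, ha, ← measure_smul_setAverage f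
        (measure_ne_top _ _)]
      simp
    have h1 : Integrable (fun z => 2 * (a - c) * (f z - a)) (μ.restrict s) :=
      (hfi.sub (integrable_const _)).const_mul _
    rw [integral_add (integrable_const _) h1, integral_const_mul, h0]
    simp [mul_comm]
  rw [← key]
  refine integral_mono hlin hsq fun z => ?_
  nlinarith [sq_nonneg (f z - a)]

/-! ### From `L²` to `L^α` by interpolation -/

theorem eLpNorm_two_sq {X : Type*} [MeasurableSpace X] {μ : Measure X} (h : X → ℝ) :
    eLpNorm h 2 μ ^ 2 = ∫⁻ x, ‖h x‖ₑ ^ 2 ∂μ := by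
  rw [eLpNorm_eq_lintegral_rpow_enorm_toReal two_ne_zero ENNReal.ofNat_ne_top,
    ← ENNReal.rpow_natCast, ← ENNReal.rpow_mul]
  simp

/-- Interpolation between `L²` and `L^∞`. -/
theorem eLpNorm_le_of_sq_le {X : Type*} [MeasurableSpace X] {μ : Measure X} {h : X → ℝ}
    {α A L : ℝ} (hα : 2 ≤ α) (hA : 0 ≤ A) (hL : 0 ≤ L) (hhL : ∀ x, h x ^ 2 ≤ L)
    (hhA : eLpNorm h 2 μ ^ 2 ≤ ENNReal.ofReal A) :
    eLpNorm h (ENNReal.ofReal α) μ ≤ ENNReal.ofReal ((L ^ (α / 2 - 1) * A) ^ (1 / α)) := by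
  have hα0 : 0 < α := by linarith
  rw [eLpNorm_eq_lintegral_rpow_enorm_toReal (by simpa using hα0) ENNReal.ofReal_ne_top,
    ENNReal.toReal_ofReal hα0.le, ← ENNReal.ofReal_rpow_of_nonneg (by positivity) (by positivity)]
  refine ENNReal.rpow_le_rpow ?_ (by positivity)
  have hpt : ∀ x, ‖h x‖ₑ ^ α ≤ ENNReal.ofReal (L ^ (α / 2 - 1)) * ‖h x‖ₑ ^ 2 := by
    intro x
    have hx : ‖h x‖ₑ = ENNReal.ofReal |h x| := Real.enorm_eq_ofReal_abs _
    rw [hx, ENNReal.ofReal_rpow_of_nonneg (abs_nonneg _) hα0.le,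
      ← ENNReal.ofReal_pow (abs_nonneg _), ← ENNReal.ofReal_mul (by positivity)]
    apply ENNReal.ofReal_le_ofReal
    have h3 : |h x| ^ α = (h x ^ 2) ^ (α / 2 - 1) * |h x| ^ 2 := by
      rcases (abs_nonneg (h x)).eq_or_lt with h0 | h0
      · rw [← h0, Real.zero_rpow hα0.ne']; simp
      · rw [← sq_abs (h x), ← Real.rpow_natCast, ← Real.rpow_mul h0.le, ← Real.rpow_add h0]
        congr 1; push_cast; ring
    rw [h3]
    gcongr
    · linarith
    · exact hhL x
  calc ∫⁻ x, ‖h x‖ₑ ^ α ∂μ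
      ≤ ∫⁻ x, ENNReal.ofReal (L ^ (α / 2 - 1)) * ‖h x‖ₑ ^ 2 ∂μ := lintegral_mono hpt
    _ = ENNReal.ofReal (L ^ (α / 2 - 1)) * ∫⁻ x, ‖h x‖ₑ ^ 2 ∂μ :=
        lintegral_const_mul' _ _ ENNReal.ofReal_ne_top
    _ ≤ ENNReal.ofReal (L ^ (α / 2 - 1)) * ENNReal.ofReal A := by rw [← eLpNorm_two_sq]; gcongr
    _ = _ := (ENNReal.ofReal_mul (by positivity)).symm

/-- A bound on the tails of an `L²`-convergent sequence passes to the limit, in every `L^p`. -/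
theorem eLpNorm_sub_le_of_tendsto {X : Type*} [MeasurableSpace X] {μ : Measure X}
    {v : ℕ → X → ℝ} {u w : X → ℝ} {p C : ℝ≥0∞} (hv : ∀ n, AEStronglyMeasurable (v n) μ)
    (hu : AEStronglyMeasurable u μ) (hw : AEStronglyMeasurable w μ)
    (hlim : Tendsto (fun n => eLpNorm (v n - u) 2 μ) atTop (𝓝 0))
    (hC : ∀ᶠ n in atTop, eLpNorm (v n - w) p μ ≤ C) :
    eLpNorm (u - w) p μ ≤ C := by
  refine eLpNorm_le_of_tendstoInMeasure (u := atTop) hC ?_ fun n => (hv n).sub hw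
  refine tendstoInMeasure_of_tendsto_eLpNorm two_ne_zero (fun n => (hv n).sub hw) (hu.sub hw) ?_
  simpa using hlim

/-- If `p k` approximates `u` in `L²` at rate `2 ^ (-k dw / 2)` while the increments are bounded by
a multiple of `2 ^ (k (Q - dw) / 2)`, then `p k` approximates `u` in `L^α` as well, as long as
`α < 2 Q / (Q - dw)`, and the rate depends on the constants alone. -/
theorem exists_eLpNorm_rate {X : Type*} [MeasurableSpace X] (μ : Measure X) {dw Q α A B : ℝ}
    (hdw : 0 < dw) (hQ : dw < Q) (hA : 0 ≤ A) (hB : 0 ≤ B) (hα : 2 ≤ α)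
    (hα' : α < 2 * Q / (Q - dw)) :
    ∃ ε : ℕ → ℝ≥0∞, Tendsto ε atTop (𝓝 0) ∧ ∀ (p : ℕ → X → ℝ) (u : X → ℝ),
      (∀ k, AEStronglyMeasurable (p k) μ) → AEStronglyMeasurable u μ →
      (∀ k, eLpNorm (p k - u) 2 μ ^ 2 ≤ ENNReal.ofReal (A * ((1 / 2 : ℝ) ^ k) ^ dw)) →
      (∀ k x, (p (k + 1) x - p k x) ^ 2 ≤ B * ((1 / 2 : ℝ) ^ k) ^ (dw - Q)) →
      ∀ k, eLpNorm (u - p k) (ENNReal.ofReal α) μ ≤ ε k := by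
  have hα0 : 0 < α := by linarith
  set δ : ℝ := ((dw - Q) * (α / 2 - 1) + dw) / α with hδ
  have hδ0 : 0 < δ := by
    rw [lt_div_iff₀ (by linarith)] at hα'
    apply div_pos _ hα0
    nlinarith
  set K : ℝ := (B ^ (α / 2 - 1) * (4 * A)) ^ (1 / α) with hK
  have hK0 : 0 ≤ K := by positivity
  set θ : ℝ := (1 / 2 : ℝ) ^ δ with hθ
  have hθ0 : 0 < θ := by positivity
  have hθ1 : θ < 1 := Real.rpow_lt_one (by norm_num) (by norm_num) hδ0
  have hθ' : 0 < 1 - θ := by linarith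
  refine ⟨fun k => ENNReal.ofReal (K / (1 - θ) * θ ^ k), ?_, ?_⟩
  · have := (tendsto_pow_atTop_nhds_zero_of_lt_one hθ0.le hθ1).const_mul (K / (1 - θ))
    simpa using ENNReal.tendsto_ofReal this
  intro p u hp hu h2 hinf k
  have h1α : 1 ≤ ENNReal.ofReal α := by
    rw [← ENNReal.ofReal_one]; exact ENNReal.ofReal_le_ofReal (by linarith)
  have hstep : ∀ k, eLpNorm (p (k + 1) - p k) (ENNReal.ofReal α) μ ≤ ENNReal.ofReal (K * θ ^ k) := by
    intro k
    set ρ : ℝ := (1 / 2 : ℝ) ^ k with hρ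
    have hρ0 : 0 < ρ := by positivity
    have hsq : ∀ j, k ≤ j → eLpNorm (p j - u) 2 μ ≤ ENNReal.ofReal √(A * ρ ^ dw) := by
      intro j hj
      have h3 : eLpNorm (p j - u) 2 μ ^ 2 ≤ ENNReal.ofReal √(A * ρ ^ dw) ^ 2 := by
        rw [← ENNReal.ofReal_pow (Real.sqrt_nonneg _), Real.sq_sqrt (by positivity)]
        refine (h2 j).trans (ENNReal.ofReal_le_ofReal ?_)
        gcongr
        exact pow_le_pow_of_le_one (by norm_num) (by norm_num) hj
      exact (ENNReal.pow_le_pow_left_iff two_ne_zero).1 h3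
    have h4 : eLpNorm (p (k + 1) - p k) 2 μ ^ 2 ≤ ENNReal.ofReal (4 * A * ρ ^ dw) := by
      have h5 : eLpNorm (p (k + 1) - p k) 2 μ ≤ ENNReal.ofReal (2 * √(A * ρ ^ dw)) := by
        have h6 : p (k + 1) - p k = (p (k + 1) - u) - (p k - u) := by abel
        rw [h6, two_mul, ENNReal.ofReal_add (Real.sqrt_nonneg _) (Real.sqrt_nonneg _)]
        exact (eLpNorm_sub_le ((hp _).sub hu) ((hp _).sub hu) one_le_two).trans
          (add_le_add (hsq _ (Nat.le_succ k)) (hsq _ le_rfl))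
      calc eLpNorm (p (k + 1) - p k) 2 μ ^ 2 ≤ ENNReal.ofReal (2 * √(A * ρ ^ dw)) ^ 2 := by gcongr
        _ = ENNReal.ofReal (4 * A * ρ ^ dw) := by
          rw [← ENNReal.ofReal_pow (by positivity), mul_pow, Real.sq_sqrt (by positivity)]
          ring_nf
    refine (eLpNorm_le_of_sq_le hα (by positivity) (by positivity) (hinf k) h4).trans_eq ?_
    congr 1
    have h7 : θ ^ k = ρ ^ δ := by
      rw [hθ, hρ, ← Real.rpow_natCast, ← Real.rpow_natCast, ← Real.rpow_mul (by norm_num),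
        ← Real.rpow_mul (by norm_num), mul_comm]
    have h8 : (B * ρ ^ (dw - Q)) ^ (α / 2 - 1) * (4 * A * ρ ^ dw) =
        (B ^ (α / 2 - 1) * (4 * A)) * ρ ^ ((dw - Q) * (α / 2 - 1) + dw) := by
      rw [Real.mul_rpow hB (by positivity), ← Real.rpow_mul hρ0.le, Real.rpow_add hρ0]
      ring
    rw [h7, h8, Real.mul_rpow (by positivity) (by positivity), ← Real.rpow_mul hρ0.le, hK, hδ,
      mul_one_div]
  have htel : ∀ m, eLpNorm (p (k + m) - p k) (ENNReal.ofReal α) μ ≤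
      ENNReal.ofReal (K / (1 - θ) * θ ^ k * (1 - θ ^ m)) := by
    intro m
    induction m with
    | zero => simp
    | succ m ih =>
      have h6 : p (k + (m + 1)) - p k = (p (k + m + 1) - p (k + m)) + (p (k + m) - p k) := by
        rw [← add_assoc]; abel
      have h9 : K / (1 - θ) * θ ^ k * (1 - θ ^ (m + 1)) =
          K * θ ^ (k + m) + K / (1 - θ) * θ ^ k * (1 - θ ^ m) := by
        field_simp; ring
      rw [h6, h9, ENNReal.ofReal_add (by positivity)]
      · exact (eLpNorm_add_le ((hp _).sub (hp _)) ((hp _).sub (hp _)) h1α).trans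
          (add_le_add (hstep _) ih)
      · have : θ ^ m ≤ 1 := pow_le_one₀ hθ0.le hθ1.le
        have : 0 ≤ 1 - θ ^ m := by linarith
        positivity
  refine eLpNorm_sub_le_of_tendsto hp hu (hp k) ?_ ?_
  · have h0 : Tendsto (fun k => ENNReal.ofReal (A * ((1 / 2 : ℝ) ^ k) ^ dw)) atTop (𝓝 0) := by
      have h1 : Tendsto (fun k : ℕ => ((1 / 2 : ℝ) ^ k) ^ dw) atTop (𝓝 0) := by
        have := (tendsto_pow_atTop_nhds_zero_of_lt_one (r := (1 / 2 : ℝ)) (by norm_num)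
          (by norm_num)).rpow_const (p := dw) (Or.inr hdw.le)
        rwa [Real.zero_rpow hdw.ne'] at this
      simpa using ENNReal.tendsto_ofReal (h1.const_mul A)
    have h1 := tendsto_of_tendsto_of_tendsto_of_le_of_le tendsto_const_nhds h0
      (fun _ => zero_le) h2
    have h3 := h1.ennrpow_const (1 / 2)
    rw [ENNReal.zero_rpow_of_pos (by norm_num)] at h3
    refine h3.congr fun n => ?_
    rw [← ENNReal.rpow_natCast, ← ENNReal.rpow_mul]
    norm_num
  · filter_upwards [eventually_ge_atTop k] with j hj
    obtain ⟨m, rfl⟩ := Nat.exists_eq_add_of_le hj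
    refine (htel m).trans (ENNReal.ofReal_le_ofReal ?_)
    have : 0 ≤ θ ^ m := by positivity
    have : 0 ≤ K / (1 - θ) * θ ^ k := by positivity
    nlinarith

/-! ### Extraction and limits -/

/-- A countable family of bounded real sequences has a common convergent subsequence. -/
theorem exists_subseq_tendsto_of_bounded {ι : Type*} [Countable ι] (a : ℕ → ι → ℝ) (D : ι → ℝ)
    (ha : ∀ n i, |a n i| ≤ D i) :
    ∃ (b : ι → ℝ) (φ : ℕ → ℕ), StrictMono φ ∧
      ∀ i, Tendsto (fun n => a (φ n) i) atTop (𝓝 (b i)) := by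
  have hc : IsCompact (Set.univ.pi fun i => Set.Icc (-D i) (D i)) :=
    isCompact_univ_pi fun i => isCompact_Icc
  obtain ⟨b, -, φ, hφ, hb⟩ := hc.isSeqCompact (x := a)
    fun n i _ => ⟨(abs_le.1 (ha n i)).1, (abs_le.1 (ha n i)).2⟩
  exact ⟨b, φ, hφ, fun i => (tendsto_pi_nhds.1 hb) i⟩

/-- If a sequence stays eventually within any `ε` of some function, for the norms of `L²` and of
`L^p` for `p` in a set of exponents, then it converges to one and the same function in all these
norms: the limit is found in `L²`, and the bounds in `L^p` pass to it. -/
theorem exists_tendsto_of_approx {X : Type*} [MeasurableSpace X] {μ : Measure X}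
    {v : ℕ → X → ℝ} (hv : ∀ n, MemLp (v n) 2 μ) (S : Set ℝ≥0∞) (hS : ∀ p ∈ S, 1 ≤ p)
    (h2 : 2 ∈ S)
    (happ : ∀ p ∈ S, ∀ ε : ℝ≥0∞, 0 < ε → ∃ h : X → ℝ, AEStronglyMeasurable h μ ∧
      ∀ᶠ n in atTop, eLpNorm (v n - h) p μ ≤ ε) :
    ∃ g : X → ℝ, MemLp g 2 μ ∧
      ∀ p ∈ S, Tendsto (fun n => eLpNorm (v n - g) p μ) atTop (𝓝 0) := by
  have hhalf : ∀ ε : ℝ≥0∞, 0 < ε → 0 < ε / 2 := fun ε hε =>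
    ENNReal.div_pos hε.ne' ENNReal.ofNat_ne_top
  obtain ⟨g, hg, hg2⟩ : ∃ g : X → ℝ, MemLp g 2 μ ∧
      Tendsto (fun n => eLpNorm (v n - g) 2 μ) atTop (𝓝 0) := by
    have h : CauchySeq fun n => (hv n).toLp (v n) := by
      rw [Lp.cauchySeq_Lp_iff_cauchySeq_eLpNorm, ENNReal.tendsto_nhds_zero]
      intro ε hε
      obtain ⟨h, hh, hn⟩ := happ 2 h2 (ε / 2) (hhalf ε hε)
      rw [← prod_atTop_atTop_eq]
      filter_upwards [hn.prod_mk hn] with n hn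
      have h1 : eLpNorm (((hv n.1).toLp (v n.1) : X → ℝ) - ((hv n.2).toLp (v n.2) : X → ℝ)) 2 μ =
          eLpNorm ((v n.1 - h) - (v n.2 - h)) 2 μ := by
        rw [sub_sub_sub_cancel_right]
        exact eLpNorm_congr_ae (((hv n.1).coeFn_toLp).sub ((hv n.2).coeFn_toLp))
      rw [h1, ← ENNReal.add_halves ε]
      exact (eLpNorm_sub_le ((hv _).1.sub hh) ((hv _).1.sub hh) one_le_two).trans
        (add_le_add hn.1 hn.2)
    obtain ⟨g, hg⟩ := cauchySeq_tendsto_of_complete h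
    refine ⟨g, Lp.memLp g, ?_⟩
    rw [Lp.tendsto_Lp_iff_tendsto_eLpNorm'] at hg
    refine hg.congr fun n => eLpNorm_congr_ae ?_
    exact ((hv n).coeFn_toLp).sub (EventuallyEq.refl _ _)
  refine ⟨g, hg, fun p hp => ?_⟩
  rw [ENNReal.tendsto_nhds_zero]
  intro ε hε
  obtain ⟨h, hh, hn⟩ := happ p hp (ε / 2) (hhalf ε hε)
  have hgh := eLpNorm_sub_le_of_tendsto (fun n => (hv n).1) hg.1 hh hg2 hn
  filter_upwards [hn] with n hn
  rw [← sub_sub_sub_cancel_right (v n) g h, ← ENNReal.add_halves ε]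
  exact (eLpNorm_sub_le ((hv _).1.sub hh) (hg.1.sub hh) (hS p hp)).trans (add_le_add hn hgh)

/-! ### Averages and the Poincaré inequality -/

theorem sum_ksEnergy_le {X : Type*} [MetricSpace X] [MeasurableSpace X] [BorelSpace X]
    (μ : Measure X) (dw : ℝ) (s : Finset X) (R : ℝ) (N : ℕ)
    (hN : ∀ y : X, {p : s | y ∈ ball (p : X) R}.encard ≤ N) (f : X → ℝ) (r : ℝ) :
    ∑ p ∈ s, ksEnergy μ dw (ball p R) f r ≤ N * ksEnergy μ dw Set.univ f r := by
  set F : X → ℝ≥0∞ := fun x => (μ (ball x r))⁻¹ *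
    ∫⁻ y in ball x r, ENNReal.ofReal (|f y - f x| ^ 2 / r ^ dw) ∂μ with hF
  have h1 : ∑ p ∈ s, ksEnergy μ dw (ball p R) f r =
      ∫⁻ x, F x ∂(Measure.sum fun p : s => μ.restrict (ball (p : X) R)) := by
    rw [lintegral_sum_measure, tsum_fintype, ← Finset.sum_coe_sort]
    rfl
  rw [h1]
  calc ∫⁻ x, F x ∂(Measure.sum fun p : s => μ.restrict (ball (p : X) R))
      ≤ ∫⁻ x, F x ∂(N • μ.restrict (⋃ p : s, ball (p : X) R)) :=
        lintegral_mono' (Measure.sum_restrict_le (fun p => measurableSet_ball) hN) le_rfl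
    _ ≤ ∫⁻ x, F x ∂(N • μ) := lintegral_mono' (by gcongr; exact Measure.restrict_le_self) le_rfl
    _ = N * ksEnergy μ dw Set.univ f r := by
        rw [lintegral_smul_measure, ksEnergy, Measure.restrict_univ, nsmul_eq_mul]

/-- The averages over the balls of a separated net approximate in `L²`: the Poincaré inequality is
summed over the net, with bounded overlap and superadditivity of the lower limit. -/
theorem eLpNorm_average_sub_sq_le {X : Type*} [MetricSpace X] [MeasurableSpace X] [BorelSpace X]
    {μ : Measure X} [IsFiniteMeasure μ] {dw C lam M r : ℝ} {N : ℕ} (hC : 0 ≤ C) (hr : 0 < r)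
    {s : Finset X} (hN : ∀ y : X, {p : s | y ∈ ball (p : X) (lam * r)}.encard ≤ N)
    {π : X → X} (hπ : ∀ x, π x ∈ s ∧ dist x (π x) < r) {f : X → ℝ} (hf : MemLp f 2 μ)
    (hPI : ∀ x, ∫⁻ y in ball x r, ENNReal.ofReal (|f y - ⨍ z in ball x r, f z ∂μ| ^ 2) ∂μ ≤
      ENNReal.ofReal (C * r ^ dw) *
        liminf (fun t => ksEnergy μ dw (ball x (lam * r)) f t) (𝓝[>] 0))
    (hM : liminf (fun t => ksEnergy μ dw Set.univ f t) (𝓝[>] 0) ≤ ENNReal.ofReal M) :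
    eLpNorm ((fun x => ⨍ z in ball (π x) r, f z ∂μ) - f) 2 μ ^ 2 ≤
      ENNReal.ofReal (C * N * M * r ^ dw) := by
  set G : X → X → ℝ≥0∞ := fun p => (ball p r).indicator
    fun x => ENNReal.ofReal (|f x - ⨍ z in ball p r, f z ∂μ| ^ 2) with hG
  have hGm : ∀ p ∈ s, AEMeasurable (G p) μ := fun p _ =>
    AEMeasurable.indicator
      ((hf.1.aemeasurable.sub_const _).abs.pow_const 2).ennreal_ofReal measurableSet_ball
  have hpt : ∀ x, ‖((fun x => ⨍ z in ball (π x) r, f z ∂μ) - f) x‖ₑ ^ 2 ≤ ∑ p ∈ s, G p x := by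
    intro x
    refine le_trans ?_ (Finset.single_le_sum (f := fun p => G p x) (fun _ _ => zero_le)
      (hπ x).1)
    simp only [hG]
    rw [Set.indicator_of_mem (show x ∈ ball (π x) r from (hπ x).2), Pi.sub_apply,
      Real.enorm_eq_ofReal_abs, ← ENNReal.ofReal_pow (abs_nonneg _), abs_sub_comm]
  calc eLpNorm ((fun x => ⨍ z in ball (π x) r, f z ∂μ) - f) 2 μ ^ 2
      ≤ ∫⁻ x, ∑ p ∈ s, G p x ∂μ := by rw [eLpNorm_two_sq]; exact lintegral_mono hpt
    _ = ∑ p ∈ s, ∫⁻ x in ball p r, ENNReal.ofReal (|f x - ⨍ z in ball p r, f z ∂μ| ^ 2) ∂μ := by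
        rw [lintegral_finsetSum' s hGm]
        exact Finset.sum_congr rfl fun p _ => lintegral_indicator measurableSet_ball _
    _ ≤ ∑ p ∈ s, ENNReal.ofReal (C * r ^ dw) *
          liminf (fun t => ksEnergy μ dw (ball p (lam * r)) f t) (𝓝[>] 0) :=
        Finset.sum_le_sum fun p _ => hPI p
    _ ≤ ENNReal.ofReal (C * r ^ dw) *
          liminf (fun t => N * ksEnergy μ dw Set.univ f t) (𝓝[>] 0) := by
        rw [← Finset.mul_sum]
        gcongr
        exact (sum_liminf_le_liminf_sum _ _).trans
          (liminf_le_liminf (Eventually.of_forall fun t => sum_ksEnergy_le μ dw s _ N hN f t))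
    _ ≤ ENNReal.ofReal (C * r ^ dw) * (N * ENNReal.ofReal M) := by
        rw [ENNReal.liminf_const_mul_of_ne_top (ENNReal.natCast_ne_top N)]
        gcongr
    _ = ENNReal.ofReal (C * N * M * r ^ dw) := by
        rw [← ENNReal.ofReal_natCast, ← ENNReal.ofReal_mul (by positivity),
          ← ENNReal.ofReal_mul (by positivity)]
        congr 1; ring

/-- The averages over a ball and over a smaller ball inside it differ by at most what the Poincaré
inequality on the larger ball allows. -/
theorem sq_average_sub_average_mul_le {X : Type*} [MetricSpace X] [MeasurableSpace X]
    {μ : Measure X} [IsFiniteMeasure μ] {K M t r : ℝ} {x y : X} (hK : 0 ≤ K)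
    (hsub : ball y t ⊆ ball x r) {f : X → ℝ} (hf : MemLp f 2 μ) {E : ℝ≥0∞}
    (hPI : ∫⁻ w in ball x r, ENNReal.ofReal (|f w - ⨍ z in ball x r, f z ∂μ| ^ 2) ∂μ ≤
      ENNReal.ofReal K * E) (hM0 : 0 ≤ M) (hM : E ≤ ENNReal.ofReal M) :
    ((⨍ z in ball y t, f z ∂μ) - ⨍ z in ball x r, f z ∂μ) ^ 2 * μ.real (ball y t) ≤ K * M := by
  set a := ⨍ z in ball x r, f z ∂μ
  have hint : Integrable (fun w => (f w - a) ^ 2) μ := (hf.sub (memLp_const a)).integrable_sq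
  calc ((⨍ z in ball y t, f z ∂μ) - a) ^ 2 * μ.real (ball y t)
      ≤ ∫ w in ball y t, (f w - a) ^ 2 ∂μ := sq_setAverage_sub_mul_le hf _ a
    _ ≤ ∫ w in ball x r, (f w - a) ^ 2 ∂μ :=
        setIntegral_mono_set hint.integrableOn (Eventually.of_forall fun w => sq_nonneg _)
          hsub.eventuallyLE
    _ ≤ K * M := by
        rw [← ENNReal.ofReal_le_ofReal_iff (by positivity), ofReal_integral_eq_lintegral_ofReal
          hint.restrict (Eventually.of_forall fun w => sq_nonneg _), ENNReal.ofReal_mul hK]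
        simp only [sq_abs] at hPI
        exact hPI.trans (by gcongr)

/-- Averages at consecutive scales around nearby centres: both balls lie in `B(p, 2 ρ)`, over which
the average is compared with each of them. -/
theorem sq_average_sub_average_le {X : Type*} [MetricSpace X] [MeasurableSpace X]
    {μ : Measure X} [IsFiniteMeasure μ] {dw Q C c M ρ : ℝ} (hC : 0 ≤ C) (hc : 0 < c)
    (hM : 0 ≤ M) (hQ : 0 ≤ Q) (hρ : 0 < ρ) {p q x : X} (hp : dist x p < ρ)
    (hq : dist x q < ρ / 2) {f : X → ℝ} (hf : MemLp f 2 μ)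
    (hlowp : c * ρ ^ Q ≤ μ.real (ball p ρ)) (hlowq : c * (ρ / 2) ^ Q ≤ μ.real (ball q (ρ / 2)))
    {E : ℝ≥0∞} (hE : E ≤ ENNReal.ofReal M)
    (hPI : ∫⁻ w in ball p (2 * ρ), ENNReal.ofReal (|f w - ⨍ z in ball p (2 * ρ), f z ∂μ| ^ 2) ∂μ ≤
      ENNReal.ofReal (C * (2 * ρ) ^ dw) * E) :
    ((⨍ z in ball q (ρ / 2), f z ∂μ) - ⨍ z in ball p ρ, f z ∂μ) ^ 2 ≤
      4 * C * M * 2 ^ dw * 2 ^ Q / c * ρ ^ (dw - Q) := by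
  set a := ⨍ z in ball p (2 * ρ), f z ∂μ
  have hK : 0 ≤ C * (2 * ρ) ^ dw := by positivity
  have hsubq : ball q (ρ / 2) ⊆ ball p (2 * ρ) := by
    apply ball_subset_ball'
    have := dist_triangle_left q p x
    linarith
  have hsubp : ball p ρ ⊆ ball p (2 * ρ) := ball_subset_ball (by linarith)
  have h1 := sq_average_sub_average_mul_le hK hsubq hf hPI hM hE
  have h2 := sq_average_sub_average_mul_le hK hsubp hf hPI hM hE
  set V := c * (ρ / 2) ^ Q with hV
  have hV0 : 0 < V := by positivity
  have hVp : V ≤ μ.real (ball p ρ) := by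
    refine le_trans ?_ hlowp
    rw [hV]
    gcongr
    linarith
  set u := ⨍ z in ball q (ρ / 2), f z ∂μ
  set v := ⨍ z in ball p ρ, f z ∂μ
  have h3 : (u - a) ^ 2 * V ≤ C * (2 * ρ) ^ dw * M :=
    (mul_le_mul_of_nonneg_left hlowq (sq_nonneg _)).trans h1
  have h4 : (v - a) ^ 2 * V ≤ C * (2 * ρ) ^ dw * M :=
    (mul_le_mul_of_nonneg_left hVp (sq_nonneg _)).trans h2
  have h5 : (u - v) ^ 2 * V ≤ 4 * (C * (2 * ρ) ^ dw * M) := by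
    have h6 : (u - v) ^ 2 ≤ 2 * (u - a) ^ 2 + 2 * (v - a) ^ 2 := by
      nlinarith [sq_nonneg ((u - a) + (v - a))]
    nlinarith [mul_le_mul_of_nonneg_right h6 hV0.le]
  have h7 : 4 * (C * (2 * ρ) ^ dw * M) =
      4 * C * M * 2 ^ dw * 2 ^ Q / c * ρ ^ (dw - Q) * V := by
    rw [hV, Real.mul_rpow two_pos.le hρ.le, Real.div_rpow hρ.le two_pos.le, Real.rpow_sub hρ]
    have : 0 < ρ ^ Q := by positivity
    have : 0 < (2 : ℝ) ^ Q := by positivity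
    field_simp
  rw [h7] at h5
  exact le_of_mul_le_mul_right h5 hV0

/-! ### Step functions with convergent coefficients -/

theorem abs_setAverage_le {X : Type*} [MeasurableSpace X] {μ : Measure X} [IsFiniteMeasure μ]
    {f : X → ℝ} (hf : MemLp f 2 μ) {M : ℝ} (hM0 : 0 ≤ M)
    (hM : eLpNorm f 2 μ ≤ ENNReal.ofReal M) {s : Set X} (hs : 0 < μ.real s) :
    |⨍ z in s, f z ∂μ| ≤ √(M ^ 2 / μ.real s) := by
  apply Real.abs_le_sqrt
  rw [le_div_iff₀ hs]
  have h1 := sq_setAverage_sub_mul_le hf s 0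
  simp only [sub_zero] at h1
  refine h1.trans ?_
  rw [← ENNReal.ofReal_le_ofReal_iff (by positivity), ofReal_integral_eq_lintegral_ofReal
    hf.integrable_sq.restrict (Eventually.of_forall fun w => sq_nonneg _),
    ENNReal.ofReal_pow hM0]
  calc ∫⁻ z in s, ENNReal.ofReal (f z ^ 2) ∂μ ≤ ∫⁻ z, ENNReal.ofReal (f z ^ 2) ∂μ :=
        setLIntegral_le_lintegral _ _
    _ = eLpNorm f 2 μ ^ 2 := by
        rw [eLpNorm_two_sq]
        refine lintegral_congr fun z => ?_
        rw [Real.enorm_eq_ofReal_abs, ← ENNReal.ofReal_pow (abs_nonneg _), sq_abs]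
    _ ≤ _ := by gcongr

/-- If finitely many coefficients converge, then the step functions they define converge
uniformly, hence in every `L^p` of a finite measure. -/
theorem tendsto_eLpNorm_step {X : Type*} [MeasurableSpace X] {μ : Measure X} [IsFiniteMeasure μ]
    (s : Finset X) {π : X → X} (hπ : ∀ x, π x ∈ s) (a : ℕ → X → ℝ) (b : X → ℝ)
    (hab : ∀ p ∈ s, Tendsto (fun n => a n p) atTop (𝓝 (b p))) (q : ℝ≥0∞) :
    Tendsto (fun n => eLpNorm ((fun x => a n (π x)) - fun x => b (π x)) q μ) atTop (𝓝 0) := by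
  have hsum : Tendsto (fun n => ∑ p ∈ s, |a n p - b p|) atTop (𝓝 0) := by
    have : Tendsto (fun n => ∑ p ∈ s, |a n p - b p|) atTop (𝓝 (∑ p ∈ s, |b p - b p|)) :=
      tendsto_finsetSum _ fun p hp => ((hab p hp).sub_const _).abs
    simpa using this
  have hlim : Tendsto (fun n => μ Set.univ ^ q.toReal⁻¹ *
      ENNReal.ofReal (∑ p ∈ s, |a n p - b p|)) atTop (𝓝 0) := by
    have := ENNReal.Tendsto.const_mul (a := μ Set.univ ^ q.toReal⁻¹)
      (ENNReal.tendsto_ofReal hsum)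
      (Or.inr (ENNReal.rpow_ne_top_of_nonneg (by positivity) (measure_ne_top _ _)))
    simpa using this
  refine tendsto_of_tendsto_of_tendsto_of_le_of_le tendsto_const_nhds hlim (fun _ => zero_le)
    fun n => eLpNorm_le_of_ae_bound (Eventually.of_forall fun x => ?_)
  exact Finset.single_le_sum (f := fun p => |a n p - b p|) (fun _ _ => abs_nonneg _) (hπ x)

/-! ### Compactness -/

theorem theorem4p4 {X : Type*} [MetricSpace X] [CompactSpace X] [MeasurableSpace X]
    [BorelSpace X] (μ : Measure X) [μ.Regular] (hVD : VolumeDoubling μ)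
    (Q : ℝ) (hQ : HasMassBound μ Q) (dw : ℝ) (hdw : 2 < dw)
    (hPI : KSPoincare μ dw) (hQdw : dw < Q)
    (f : ℕ → X → ℝ) (hf : ∀ n, f n ∈ KSSpace μ dw)
    (hbdd : (⨆ n, (eLpNorm (f n) 2 μ +
      liminf (fun r => ksEnergy μ dw Set.univ (f n) r) (𝓝[>] 0))) < ∞) :
    ∃ φ : ℕ → ℕ, StrictMono φ ∧ ∃ g : X → ℝ,
      ∀ α : ℝ, 1 ≤ α → α < 2 * Q / (Q - dw) →
        (∀ k, MemLp (f (φ k)) (ENNReal.ofReal α) μ) ∧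
        MemLp g (ENNReal.ofReal α) μ ∧
        Tendsto (fun k => eLpNorm (f (φ k) - g) (ENNReal.ofReal α) μ) atTop (𝓝 0) := by
  rcases isEmpty_or_nonempty X with hX | hX
  · have hμ : μ = 0 := Measure.eq_zero_of_isEmpty μ
    exact ⟨id, strictMono_id, 0, fun α _ _ => by simp [hμ]⟩
  obtain ⟨C, lam, hC, hlam, hPI⟩ := hPI
  obtain ⟨N, hN⟩ := hQ.exists_overlap_bound hVD hlam
  obtain ⟨c, hc, hlow⟩ := hQ.exists_lower_bound hVD
  obtain ⟨M, hM0, hML, hME⟩ : ∃ M : ℝ, 0 ≤ M ∧ (∀ n, eLpNorm (f n) 2 μ ≤ ENNReal.ofReal M) ∧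
      ∀ n, liminf (fun r => ksEnergy μ dw Set.univ (f n) r) (𝓝[>] 0) ≤ ENNReal.ofReal M := by
    have hle := le_iSup fun n => eLpNorm (f n) 2 μ +
      liminf (fun r => ksEnergy μ dw Set.univ (f n) r) (𝓝[>] 0)
    rw [← ENNReal.ofReal_toReal hbdd.ne] at hle
    exact ⟨_, ENNReal.toReal_nonneg, fun n => le_self_add.trans (hle n),
      fun n => le_add_self.trans (hle n)⟩
  have hf2 : ∀ n, MemLp (f n) 2 μ := fun n => (hf n).1
  set ρ : ℕ → ℝ := fun k => (1 / 2 : ℝ) ^ k with hρ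
  have hρ0 : ∀ k, 0 < ρ k := fun k => by simp only [hρ]; positivity
  have hρ1 : ∀ k, ρ k ≤ 1 := fun k => pow_le_one₀ (by norm_num) (by norm_num)
  have hρs : ∀ k, ρ (k + 1) = ρ k / 2 := fun k => by simp only [hρ, pow_succ]; ring
  choose s hsep hcov using fun k => exists_finset_separated_cover (X := X) (hρ0 k)
  choose π hπm hπ using fun k => exists_measurable_selection (s k) (ρ k)
  have hπ' : ∀ k x, π k x ∈ s k ∧ dist x (π k x) < ρ k := fun k x => hπ k x (hcov k x)
  set a : ℕ → ℕ → X → ℝ := fun n k p => ⨍ z in ball p (ρ k), f n z ∂μ with ha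
  -- One subsequence serves all the coefficients, as the nets of all scales are countable together.
  obtain ⟨b, φ, hφ, hb⟩ := exists_subseq_tendsto_of_bounded
    (ι := Σ k : ℕ, s k) (fun n i => a n i.1 i.2)
    (fun i => √(M ^ 2 / μ.real (ball (i.2 : X) (ρ i.1))))
    fun n i => abs_setAverage_le (hf2 n) hM0 (hML n) (hVD.measureReal_ball_pos _ (hρ0 _))
  classical
  set h : ℕ → X → ℝ := fun k p => if hp : p ∈ s k then b ⟨k, ⟨p, hp⟩⟩ else 0 with hh
  have hlim : ∀ k, ∀ p ∈ s k, Tendsto (fun n => a (φ n) k p) atTop (𝓝 (h k p)) := by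
    intro k p hp
    simp only [hh, dif_pos hp]
    exact hb ⟨k, ⟨p, hp⟩⟩
  have ham : ∀ n k, AEStronglyMeasurable (fun x => a n k (π k x)) μ := fun n k =>
    (hπm k (a n k)).aestronglyMeasurable
  have hhm : ∀ k, AEStronglyMeasurable (fun x => h k (π k x)) μ := fun k =>
    (hπm k (h k)).aestronglyMeasurable
  have hstep : ∀ n k x, (a n (k + 1) (π (k + 1) x) - a n k (π k x)) ^ 2 ≤
      4 * C * M * 2 ^ dw * 2 ^ Q / c * ρ k ^ (dw - Q) := by
    intro n k x
    have hq := (hπ' (k + 1) x).2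
    simp only [ha]
    rw [hρs] at hq ⊢
    refine sq_average_sub_average_le hC.le hc hM0 (by linarith) (hρ0 k) (hπ' k x).2 hq
      (hf2 n) (hlow _ _ (hρ0 k) (hρ1 k)) (hlow _ _ (by linarith [hρ0 k]) (by linarith [hρ1 k]))
      (E := liminf (fun t => ksEnergy μ dw (ball (π k x) (lam * (2 * ρ k))) (f n) t) (𝓝[>] 0))
      ?_ (hPI (f n) (hf n) (π k x) (2 * ρ k) (by linarith [hρ0 k]))
    refine (liminf_le_liminf (Eventually.of_forall fun t => ?_)).trans (hME n)
    exact lintegral_mono_set (Set.subset_univ _)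
  have hL2 : ∀ n k, eLpNorm ((fun x => a n k (π k x)) - f n) 2 μ ^ 2 ≤
      ENNReal.ofReal (C * N * M * ρ k ^ dw) := fun n k =>
    eLpNorm_average_sub_sq_le hC.le (hρ0 k) (hN (ρ k) (s k) (hρ0 k) (hsep k)) (hπ' k) (hf2 n)
      (fun x => hPI (f n) (hf n) x (ρ k) (hρ0 k)) (hME n)
  -- The bounds `hL2` and `hstep` do not depend on `n`, so neither does the rate in `L^α`.
  have hrate : ∀ α : ℝ, 2 ≤ α → α < 2 * Q / (Q - dw) → ∃ ε : ℕ → ℝ≥0∞, Tendsto ε atTop (𝓝 0) ∧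
      ∀ n k, eLpNorm (f n - fun x => a n k (π k x)) (ENNReal.ofReal α) μ ≤ ε k := by
    intro α h2 hα
    obtain ⟨ε, hε, H⟩ := exists_eLpNorm_rate μ (by linarith) hQdw
      (show 0 ≤ C * N * M by positivity)
      (show 0 ≤ 4 * C * M * 2 ^ dw * 2 ^ Q / c by positivity) h2 hα
    exact ⟨ε, hε, fun n => H (fun k x => a n k (π k x)) (f n) (ham n) (hf2 n).1 (hL2 n) (hstep n)⟩
  have h2Q : 2 < 2 * Q / (Q - dw) := by
    rw [lt_div_iff₀ (by linarith)]; linarith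
  have hmem : ∀ α : ℝ, 2 ≤ α → α < 2 * Q / (Q - dw) → ∀ n, MemLp (f n) (ENNReal.ofReal α) μ := by
    intro α h2 hα n
    obtain ⟨ε, hε, H⟩ := hrate α h2 hα
    obtain ⟨k, hk⟩ := (hε.eventually (gt_mem_nhds ENNReal.zero_lt_top)).exists
    have h1 : MemLp (f n - fun x => a n k (π k x)) (ENNReal.ofReal α) μ :=
      ⟨(hf2 n).1.sub (ham n k), (H n k).trans_lt hk⟩
    have h3 : MemLp (fun x => a n k (π k x)) (ENNReal.ofReal α) μ := by
      refine MemLp.of_bound (ham n k) (∑ p ∈ s k, |a n k p|) (Eventually.of_forall fun x => ?_)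
      exact Finset.single_le_sum (f := fun p => |a n k p|) (fun _ _ => abs_nonneg _) (hπ' k x).1
    simpa using h1.add h3
  set S : Set ℝ≥0∞ := ENNReal.ofReal '' Set.Ico 2 (2 * Q / (Q - dw)) with hS
  obtain ⟨g, hg2, hg⟩ := exists_tendsto_of_approx (v := fun n => f (φ n)) (fun n => hf2 _) S
    (by
      rintro _ ⟨α, hα, rfl⟩
      rw [← ENNReal.ofReal_one]
      exact ENNReal.ofReal_le_ofReal (by linarith [hα.1]))
    ⟨2, ⟨le_rfl, h2Q⟩, by simp⟩
    (by
      rintro _ ⟨α, hα, rfl⟩ η hη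
      obtain ⟨ε, hε, H⟩ := hrate α hα.1 hα.2
      have hη2 : 0 < η / 2 := ENNReal.div_pos hη.ne' ENNReal.ofNat_ne_top
      obtain ⟨k, hk⟩ := (hε.eventually (gt_mem_nhds hη2)).exists
      refine ⟨fun x => h k (π k x), hhm k, ?_⟩
      filter_upwards [(tendsto_eLpNorm_step (μ := μ) (s k) (fun x => (hπ' k x).1)
        (fun n => a (φ n) k) (h k) (hlim k) (ENNReal.ofReal α)).eventually (gt_mem_nhds hη2)]
        with n hn
      rw [← sub_add_sub_cancel (f (φ n)) (fun x => a (φ n) k (π k x)), ← ENNReal.add_halves η]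
      refine (eLpNorm_add_le ((hf2 _).1.sub (ham _ k)) ((ham _ k).sub (hhm k)) ?_).trans
        (add_le_add ((H _ k).trans hk.le) hn.le)
      rw [← ENNReal.ofReal_one]
      exact ENNReal.ofReal_le_ofReal (by linarith [hα.1]))
  refine ⟨φ, hφ, g, fun α hα1 hα => ?_⟩
  -- Exponents below `2` are dominated by the exponent `2`, the measure being finite.
  have hβ : max α 2 < 2 * Q / (Q - dw) := max_lt hα h2Q
  have hle : ENNReal.ofReal α ≤ ENNReal.ofReal (max α 2) :=
    ENNReal.ofReal_le_ofReal (le_max_left _ _)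
  have hconv := hg _ ⟨max α 2, ⟨le_max_right _ _, hβ⟩, rfl⟩
  have hmemf : ∀ n, MemLp (f n) (ENNReal.ofReal α) μ := fun n =>
    (hmem _ (le_max_right _ _) hβ n).mono_exponent hle
  have hconv' : Tendsto (fun k => eLpNorm (f (φ k) - g) (ENNReal.ofReal α) μ) atTop (𝓝 0) := by
    have hexp : 0 ≤ 1 / (ENNReal.ofReal α).toReal - 1 / (ENNReal.ofReal (max α 2)).toReal := by
      rw [ENNReal.toReal_ofReal (by linarith), ENNReal.toReal_ofReal (by positivity), sub_nonneg]
      exact one_div_le_one_div_of_le (by linarith) (le_max_left _ _)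
    have h0 := ENNReal.Tendsto.mul_const hconv
      (Or.inr (ENNReal.rpow_ne_top_of_nonneg hexp (measure_ne_top μ Set.univ)))
    rw [zero_mul] at h0
    exact tendsto_of_tendsto_of_tendsto_of_le_of_le tendsto_const_nhds h0 (fun _ => zero_le)
      fun k => eLpNorm_le_eLpNorm_mul_rpow_measure_univ hle ((hf2 _).1.sub hg2.1)
  refine ⟨fun k => hmemf _, ?_, hconv'⟩
  obtain ⟨k, hk⟩ := (hconv'.eventually (gt_mem_nhds ENNReal.zero_lt_top)).exists
  have h1 : MemLp (f (φ k) - g) (ENNReal.ofReal α) μ := ⟨(hf2 _).1.sub hg2.1, hk⟩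
  simpa using (hmemf (φ k)).sub h1
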